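/- Throughout, $D$ is an integral domain with quotient field $K$. A semistar operation $\star$ on $D$ is a map $E\mapsto E^\star$ on the nonzero $D$-submodules of $K$ such that, for all $0\neq x\in K$ and all nonzero $D$-submodules $E,F$ of $K$: $(xE)^\star=xE^\star$; $E\subseteq F$ implies $E^\star\subseteq F^\star$; $E\subseteq E^\star$ and $(E^\star)^\star=E^\star$. It is a (semi)star operation if $D^\star=D$. Write $\star\le\star'$ if $E^\star\subseteq E^{\star'}$ for all $E$. The associated finite type operation is $E^{\star_f}=\bigcup\{F^\star : 0\ne F\subseteq E,\ F \text{ a finitely generated } D\text{-submodule}\}$. A quasi-$\star$-ideal of $D$ is a nonzero ideal $I$ of $D$ with $I=I^\star\cap D$, and $D$ is $\star$-Noetherian if it satisfies the ascending chain condition on quasi-$\star$-ideals. $D$ is a P$\star$MD if $(II^{-1})^{\star_f}=D^{\star_f}$ for every nonzero finitely generated ideal $I$ of $D$, where $I^{-1}=(D:_K I)$. $D$ is a $\star$-Dedekind domain ($\star$-DD) if it is $\star$-Noetherian and a P$\star$MD. An overring of $D$ is a ring $T$ with $D\subseteq T\subseteq K$. If $\star$ is a semistar operation on $D$ and $\star'$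 one on $T$, then $T$ is $(\star,\star')$-linked to $D$ if, for each nonzero finitely generated ideal $F$ of $D$, $F^\star=D^\star$ implies $(FT)^{\star'}=T^{\star'}$. Finally, $\dot\star$ denotes the (semi)star operation $E\mapsto E^\star$ on the overring $D^\star$ of $D$ ($E$ a nonzero $D^\star$-submodule of $K$). Fields count as Dedekind domains and as Krull domains. **Theorem.** Let $D$ be an integral domain. (1) Let $\star\le\star'$ be two semistar operations on $D$. If $D$ is a $\star$-DD, then $D$ is a $\star'$-DD. In particular: (1a) if $D$ is a Dedekind domain, then $D$ is a $\star$-DD for every semistar operation $\star$ on $D$; (1b) if $\star$ is a (semi)star operation on $D$ and $D$ is a $\star$-DD, then $D$ is a Krull domain. (2) Let $T$ be an overring of $D$, $\star$ a semistar operation on $D$ and $\star'$ a semistar operation on $T$, and assume that $T$ is $(\star,\star')$-linked to $D$. If $D$ is a $\star$-DD, then $T$ is a $\star'$-DD. In particular, if $D$ is a $\star$-DD, then $D^\star$ is a $\dot\star$-DD. -/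

import Mathlib

open scoped Pointwise

/-- A semistar operation on an integral domain `D` with quotient field `K`: a map `E ↦ E^⋆` on the
nonzero `D`-submodules of `K` satisfying the three semistar axioms. The map is written as a total
function on all `D`-submodules of `K`, with the value at the zero submodule normalized to be zero.
(With this normalization the three axioms hold trivially at the zero submodule, and `E^⋆ ≠ 0` for
`E ≠ 0` follows from `E ⊆ E^⋆`.) -/
structure SemistarOperation (D K : Type*) [CommRing D] [Field K] [Algebra D K] where
  toFun : Submodule D K → Submodule D K
  map_bot : toFun ⊥ = ⊥
  map_smul : ∀ (x : K) (E : Submodule D K), x ≠ 0 → toFun (x • E) = x • toFun E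
  mono : ∀ E F : Submodule D K, E ≤ F → toFun E ≤ toFun F
  le_star : ∀ E : Submodule D K, E ≤ toFun E
  idem : ∀ E : Submodule D K, toFun (toFun E) = toFun E

namespace SemistarOperation

variable {D K : Type*} [CommRing D] [Field K] [Algebra D K]

instance : CoeFun (SemistarOperation D K) (fun _ => Submodule D K → Submodule D K) := ⟨toFun⟩

/-- `⋆₁ ≤ ⋆₂` means `E^⋆₁ ⊆ E^⋆₂` for every nonzero `D`-submodule `E` of `K`. -/
instance : LE (SemistarOperation D K) :=
  ⟨fun s t => ∀ E : Submodule D K, E ≠ ⊥ → s E ≤ t E⟩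

/-- A (semi)star operation: a semistar operation with `D^⋆ = D`. -/
def IsSemiStar (s : SemistarOperation D K) : Prop := s 1 = 1

theorem mul_mem_star (s : SemistarOperation D K) {x : K} {E F : Submodule D K}
    (h : ∀ y ∈ E, x * y ∈ F) {z : K} (hz : z ∈ s E) : x * z ∈ s F := by
  by_cases hx : x = 0
  · simp [hx]
  · have h1 : x • E ≤ F := by
      rintro _ ⟨y, hy, rfl⟩
      exact h y hy
    have h2 : x * z ∈ x • s E := Submodule.smul_mem_pointwise_smul z x _ hz
    rw [← s.map_smul x E hx] at h2
    exact s.mono _ _ h1 h2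

/-- The semistar operation of finite type `⋆_f` associated to `⋆`:
`E^{⋆_f} = ⋃ {F^⋆ | F ⊆ E finitely generated}`. -/
def finiteType (s : SemistarOperation D K) : SemistarOperation D K where
  toFun E :=
    { carrier := {x | ∃ F : Submodule D K, F.FG ∧ F ≤ E ∧ x ∈ s F}
      zero_mem' := ⟨⊥, Submodule.fg_bot, bot_le, zero_mem _⟩
      add_mem' := by
        rintro a b ⟨F, hF, hFE, ha⟩ ⟨G, hG, hGE, hb⟩
        exact ⟨F ⊔ G, hF.sup hG, sup_le hFE hGE,
          add_mem (s.mono _ _ le_sup_left ha) (s.mono _ _ le_sup_right hb)⟩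
      smul_mem' := by
        rintro c a ⟨F, hF, hFE, ha⟩
        exact ⟨F, hF, hFE, Submodule.smul_mem _ c ha⟩ }
  map_bot := by
    refine le_antisymm ?_ bot_le
    rintro x ⟨F, _, hF, hx⟩
    rw [le_bot_iff.mp hF, s.map_bot] at hx
    exact hx
  map_smul := by
    have key : ∀ (x : K) (E : Submodule D K) (y : K),
        (∃ F : Submodule D K, F.FG ∧ F ≤ E ∧ y ∈ s F) →
        ∃ F : Submodule D K, F.FG ∧ F ≤ x • E ∧ x * y ∈ s F := by
      rintro x E y ⟨F, hF, hFE, hy⟩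
      refine ⟨x • F, hF.map _, Submodule.map_mono hFE, s.mul_mem_star (E := F) ?_ hy⟩
      intro z hz
      exact Submodule.smul_mem_pointwise_smul z x _ hz
    intro x E hx
    apply le_antisymm
    · intro y hy
      have h := key x⁻¹ (x • E) y hy
      rw [inv_smul_smul₀ hx] at h
      exact ⟨x⁻¹ * y, h, by simp [hx]⟩
    · rintro _ ⟨y, hy, rfl⟩
      exact key x E y hy
  mono := by
    rintro E E' h x ⟨F, hF, hFE, hx⟩
    exact ⟨F, hF, hFE.trans h, hx⟩
  le_star := by
    intro E x hx
    exact ⟨Submodule.span D {x}, Submodule.fg_span_singleton x, by simpa using hx,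
      s.le_star _ (Submodule.mem_span_singleton_self x)⟩
  idem := by
    intro E
    apply le_antisymm
    · rintro x ⟨F, hF, hFE, hx⟩
      have key : ∀ S : Finset K, (∀ y ∈ S, ∃ G : Submodule D K, G.FG ∧ G ≤ E ∧ y ∈ s G) →
          ∃ G : Submodule D K, G.FG ∧ G ≤ E ∧ ∀ y ∈ S, y ∈ s G := by
        classical
        intro S
        induction S using Finset.induction_on with
        | empty => exact fun _ => ⟨⊥, Submodule.fg_bot, bot_le, by simp⟩
        | insert a S _ ih =>
          intro h
          obtain ⟨G, hG, hGE, hGS⟩ := ih fun y hy => h y (Finset.mem_insert_of_mem hy)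
          obtain ⟨H, hH, hHE, ha⟩ := h a (Finset.mem_insert_self a S)
          refine ⟨G ⊔ H, hG.sup hH, sup_le hGE hHE, ?_⟩
          intro y hy
          rcases Finset.mem_insert.mp hy with rfl | hy
          · exact s.mono _ _ le_sup_right ha
          · exact s.mono _ _ le_sup_left (hGS y hy)
      obtain ⟨S, rfl⟩ := hF
      obtain ⟨G, hG, hGE, hGS⟩ := key S fun y hy => hFE (Submodule.subset_span hy)
      refine ⟨G, hG, hGE, ?_⟩
      have h := s.mono _ _ (Submodule.span_le.mpr hGS) hx
      rwa [s.idem] at h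
    · intro x hx
      exact ⟨Submodule.span D {x}, Submodule.fg_span_singleton x, by simpa using hx,
        s.le_star _ (Submodule.mem_span_singleton_self x)⟩

/-- A quasi-`⋆`-ideal of `D`: a nonzero ideal `I` with `I^⋆ ∩ D = I`. -/
def IsQuasiIdeal (s : SemistarOperation D K) (I : Ideal D) : Prop :=
  I ≠ ⊥ ∧ (s (IsLocalization.coeSubmodule K I)).comap (Algebra.linearMap D K) = I

/-- `D` is `⋆`-Noetherian: ascending chain condition on quasi-`⋆`-ideals. -/
def IsNoetherian (s : SemistarOperation D K) : Prop :=
  ∀ I : ℕ →o Ideal D, (∀ n, s.IsQuasiIdeal (I n)) → ∃ n, ∀ m, n ≤ m → I n = I m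

/-- `E` is `⋆`-invertible: `(E E⁻¹)^⋆ = D^⋆`, where `E⁻¹ = (D :_K E)`, written `1 / E`. -/
def IsInvertible (s : SemistarOperation D K) (E : Submodule D K) : Prop :=
  s (E * (1 / E)) = s 1

/-- `D` is a Prüfer `⋆`-multiplication domain: every nonzero finitely generated ideal of `D` is
`⋆_f`-invertible. -/
def IsPruferMD (s : SemistarOperation D K) : Prop :=
  ∀ I : Ideal D, I ≠ ⊥ → I.FG → s.finiteType.IsInvertible (IsLocalization.coeSubmodule K I)

/-- `D` is a `⋆`-Dedekind domain: `D` is `⋆`-Noetherian and a Prüfer `⋆`-multiplication domain. -/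
def IsDedekind (s : SemistarOperation D K) : Prop :=
  s.IsNoetherian ∧ s.IsPruferMD

/-- The overring `T` of `D` (a ring with `D ⊆ T ⊆ K`) is `(⋆, ⋆')`-linked to `D`: for each nonzero
finitely generated ideal `F` of `D`, `F^⋆ = D^⋆` implies `(FT)^⋆' = T^⋆'`. -/
def IsLinked (s : SemistarOperation D K) (T : Subalgebra D K) (s' : SemistarOperation T K) : Prop :=
  ∀ F : Ideal D, F ≠ ⊥ → F.FG → s (IsLocalization.coeSubmodule K F) = s 1 →
    s' (IsLocalization.coeSubmodule K (F.map (algebraMap D T))) = s' 1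

/-- The semistar operation induced by `⋆` on an overring `T` of `D`: `E ↦ E^⋆` for every
`T`-submodule `E` of `K`. -/
def restrict (s : SemistarOperation D K) (T : Subalgebra D K) : SemistarOperation T K where
  toFun E :=
    { carrier := s (E.restrictScalars D)
      zero_mem' := zero_mem _
      add_mem' := add_mem
      smul_mem' := fun c _ hx =>
        s.mul_mem_star (x := (c : K)) (fun _ hy => E.smul_mem c hy) hx }
  map_bot := by
    apply SetLike.coe_injective
    exact congrArg (fun E : Submodule D K => (E : Set K)) s.map_bot
  map_smul x E hx := by
    apply SetLike.coe_injective
    exact congrArg (fun F : Submodule D K => (F : Set K)) (s.map_smul x (E.restrictScalars D) hx)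
  mono E F h := s.mono (E.restrictScalars D) (F.restrictScalars D) h
  le_star E := s.le_star (E.restrictScalars D)
  idem E := by
    apply SetLike.coe_injective
    exact congrArg (fun F : Submodule D K => (F : Set K)) (s.idem (E.restrictScalars D))

/-- The overring `D^⋆` of `D`. -/
def overring (s : SemistarOperation D K) : Subalgebra D K where
  carrier := s 1
  mul_mem' := by
    intro a b ha hb
    have h : a * b ∈ s (s 1) := by
      refine s.mul_mem_star (E := 1) ?_ hb
      intro y hy
      obtain ⟨d, rfl⟩ := Submodule.mem_one.mp hy
      rw [mul_comm, ← Algebra.smul_def]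
      exact Submodule.smul_mem _ d ha
    rwa [s.idem] at h
  add_mem' := add_mem
  algebraMap_mem' d := s.le_star 1 (Submodule.mem_one.mpr ⟨d, rfl⟩)

/-- The (semi)star operation induced by `⋆` on the overring `D^⋆`. -/
def dot (s : SemistarOperation D K) : SemistarOperation s.overring K :=
  s.restrict s.overring

end SemistarOperation

/-- `D`, with quotient field `K`, is a Krull domain: `D` is the intersection (inside `K`) of a
family of discrete valuation rings of `K` such that every nonzero element of `K` is a unit in all
but finitely many of them. The family may be empty, so that a field is a Krull domain. -/
def IsKrullDomain (D K : Type*) [CommRing D] [Field K] [Algebra D K] : Prop :=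
  ∃ 𝒱 : Set (ValuationSubring K),
    (∀ V ∈ 𝒱, IsDiscreteValuationRing V) ∧
    (∀ x : K, x ∈ (algebraMap D K).range ↔ ∀ V ∈ 𝒱, x ∈ V) ∧
    (∀ x : K, x ≠ 0 → {V ∈ 𝒱 | V.valuation x ≠ 1}.Finite)

/-!
Call a finitely generated ideal `G` of `D` dense if `G^⋆ = D^⋆`. The argument rests on two facts
about dense ideals in a `⋆`-Dedekind domain.

* `IsDedekind.exists_fg_mul_mem`: if `y ∈ D` lies in `I^⋆`, then `y G ⊆ I` for a dense `G`.
  The chain condition yields a finitely generated `F ⊆ I` with `y ∈ F^⋆`, and the Prüfer condition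
  is applied to `F + yD`.
* `IsPruferMD.exists_fg_denominator`: for `x ∈ K` some dense `G` lies in `A⁻¹ + x A⁻¹`, where
  `A = D + xD` and `A⁻¹ = {a ∈ D | x a ∈ D}`.

Enlarging `⋆` shrinks the set of quasi-ideals and keeps dense ideals dense, which settles the
comparison of two semistar operations; for Dedekind domains both conditions hold outright.

Linkedness says exactly that dense ideals of `D` extend to dense ideals of `T`. Clearing
denominators, the Prüfer condition passes from `D` to `T`. For the chain condition, a
quasi-`⋆'`-ideal `J` of `T` contracts to a quasi-`⋆`-ideal of `D` by the first fact, and is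
recovered from the contraction as `((J ∩ D) T)^⋆' ∩ T` by the second one. Contraction thus
embeds the ordered set of quasi-`⋆'`-ideals of `T` into that of quasi-`⋆`-ideals of `D`.

For the Krull property the valuation rings are the localizations `D_P` at the prime
quasi-`⋆`-ideals `P`. A dense ideal is never contained in such a `P`, so the second fact makes `D_P`
a valuation ring and the first one makes it Noetherian. If `D^⋆ = D`, then for `x ∈ K ∖ D` the ideal
`(D : x)` is a proper quasi-`⋆`-ideal, hence lies in a prime one, and so `D` is the intersection of
the `D_P`. Finally the prime quasi-`⋆`-ideals are pairwise incomparable, and Noetherian induction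
shows that every quasi-`⋆`-ideal lies in only finitely many of them.
-/

/-! ### Semistar closures and quasi-`⋆`-ideals -/

namespace SemistarOperation

section Semistar

variable {D K : Type*} [CommRing D] [Field K] [Algebra D K]

theorem star_eq_star_one_iff (s : SemistarOperation D K) {E : Submodule D K} (hE : E ≤ 1) :
    s E = s 1 ↔ (1 : K) ∈ s E := by
  constructor
  · intro h
    rw [h]
    exact s.le_star 1 (Submodule.one_le.mp le_rfl)
  · intro h
    refine le_antisymm (s.mono _ _ hE) ?_
    rw [← s.idem E]
    exact s.mono _ _ (Submodule.one_le.mpr h)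

theorem star_le_star_of_le (s : SemistarOperation D K) {E F : Submodule D K} (h : E ≤ s F) :
    s E ≤ s F := by
  rw [← s.idem F]
  exact s.mono _ _ h

theorem star_mul_le (s : SemistarOperation D K) (E F : Submodule D K) :
    s E * F ≤ s (E * F) := by
  refine Submodule.mul_le.mpr fun x hx y hy => ?_
  rw [mul_comm x y]
  refine s.mul_mem_star (E := E) (fun z hz => ?_) hx
  rw [mul_comm y z]
  exact Submodule.mul_mem_mul hz hy

theorem coeSubmodule_le_one (I : Ideal D) : IsLocalization.coeSubmodule K I ≤ 1 := by
  rintro _ ⟨y, _, rfl⟩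
  exact Submodule.mem_one.mpr ⟨y, rfl⟩

theorem mem_of_isQuasiIdeal {s : SemistarOperation D K} {I : Ideal D} (hI : s.IsQuasiIdeal I)
    {y : D} (hy : algebraMap D K y ∈ s (IsLocalization.coeSubmodule K I)) : y ∈ I := by
  rw [← hI.2]
  exact hy

theorem ne_bot_of_one_mem_star (s : SemistarOperation D K) {I : Ideal D}
    (h : (1 : K) ∈ s (IsLocalization.coeSubmodule K I)) : I ≠ ⊥ := by
  rintro rfl
  rw [IsLocalization.coeSubmodule_bot, s.map_bot] at h
  exact one_ne_zero ((Submodule.mem_bot D).mp h)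

theorem isPruferMD_iff (s : SemistarOperation D K) :
    s.IsPruferMD ↔ ∀ I : Ideal D, I ≠ ⊥ → I.FG → ∃ F : Submodule D K, F.FG ∧
      F ≤ IsLocalization.coeSubmodule K I * (1 / IsLocalization.coeSubmodule K I) ∧
      (1 : K) ∈ s F :=
  forall₃_congr fun _ _ _ => s.finiteType.star_eq_star_one_iff Submodule.mul_one_div_le_one

/-- The quasi-`⋆`-ideal `I^⋆ ∩ D` generated by an ideal `I`. -/
def closure (s : SemistarOperation D K) (I : Ideal D) : Ideal D :=
  (s (IsLocalization.coeSubmodule K I)).comap (Algebra.linearMap D K)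

theorem mem_closure {s : SemistarOperation D K} {I : Ideal D} {y : D} :
    y ∈ s.closure I ↔ algebraMap D K y ∈ s (IsLocalization.coeSubmodule K I) :=
  Iff.rfl

theorem le_closure (s : SemistarOperation D K) (I : Ideal D) : I ≤ s.closure I :=
  fun y hy => s.le_star _ ⟨y, hy, rfl⟩

theorem isQuasiIdeal_closure (s : SemistarOperation D K) {I : Ideal D} (hI : I ≠ ⊥) :
    s.IsQuasiIdeal (s.closure I) := by
  refine ⟨ne_bot_of_le_ne_bot hI (s.le_closure I), le_antisymm (fun y hy => ?_) (s.le_closure _)⟩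
  refine s.star_le_star_of_le ?_ hy
  rintro _ ⟨z, hz, rfl⟩
  exact hz

theorem closure_le_of_isQuasiIdeal {s : SemistarOperation D K} {I P : Ideal D}
    (hP : s.IsQuasiIdeal P) (h : I ≤ P) : s.closure I ≤ P :=
  fun _ hy => mem_of_isQuasiIdeal hP (s.mono _ _ (Submodule.map_mono h) hy)

theorem IsNoetherian.wellFoundedGT {s : SemistarOperation D K} (h : s.IsNoetherian) :
    WellFoundedGT {I : Ideal D // s.IsQuasiIdeal I} := by
  rw [wellFoundedGT_iff_monotone_chain_condition]
  intro a
  obtain ⟨n, hn⟩ := h ⟨fun i => (a i).1, fun i j hij => a.2 hij⟩ fun i => (a i).2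
  exact ⟨n, fun m hm => Subtype.ext (hn m hm)⟩

/-- In a `⋆`-Noetherian domain every nonzero ideal is, up to `⋆`, finitely generated: choose a
finitely generated `F ⊆ I` for which `F^⋆ ∩ D` is maximal. -/
theorem IsNoetherian.exists_fg_le_star {s : SemistarOperation D K} (h : s.IsNoetherian)
    {I : Ideal D} (hI : I ≠ ⊥) :
    ∃ F : Ideal D, F.FG ∧ F ≠ ⊥ ∧ F ≤ I ∧
      IsLocalization.coeSubmodule K I ≤ s (IsLocalization.coeSubmodule K F) := by
  obtain ⟨a, ha, ha0⟩ := Submodule.exists_mem_ne_zero_of_ne_bot hI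
  have := h.wellFoundedGT
  let S : Set {I : Ideal D // s.IsQuasiIdeal I} :=
    {Q | ∃ F : Ideal D, F.FG ∧ F ≠ ⊥ ∧ F ≤ I ∧ Q.1 = s.closure F}
  have ha' : Ideal.span {a} ≠ ⊥ := by simpa [Ideal.span_singleton_eq_bot] using ha0
  have hS : S.Nonempty := ⟨⟨_, s.isQuasiIdeal_closure ha'⟩, Ideal.span {a},
    Submodule.fg_span_singleton a, ha', (Ideal.span_singleton_le_iff_mem I).mpr ha, rfl⟩
  obtain ⟨⟨Q, hQ⟩, ⟨F, hF, hF0, hFI, rfl⟩, hmax⟩ := WellFounded.has_min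
    (wellFounded_gt (α := {I : Ideal D // s.IsQuasiIdeal I})) S hS
  refine ⟨F, hF, hF0, hFI, ?_⟩
  rintro _ ⟨y, hy, rfl⟩
  by_contra hyF
  have hF' : F ⊔ Ideal.span {y} ≠ ⊥ := ne_bot_of_le_ne_bot hF0 le_sup_left
  refine hmax ⟨s.closure (F ⊔ Ideal.span {y}), s.isQuasiIdeal_closure hF'⟩
    ⟨F ⊔ Ideal.span {y}, Submodule.FG.sup hF (Submodule.fg_span_singleton y), hF',
      sup_le hFI ((Ideal.span_singleton_le_iff_mem I).mpr hy), rfl⟩ ?_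
  refine lt_of_le_not_ge
    (closure_le_of_isQuasiIdeal (s.isQuasiIdeal_closure hF') (le_sup_left.trans (s.le_closure _)))
    fun hle => hyF (hle (s.le_closure _ (Ideal.mem_sup_right (Ideal.mem_span_singleton_self y))))

theorem IsDedekind.of_le {s s' : SemistarOperation D K} (hle : s ≤ s') (h : s.IsDedekind) :
    s'.IsDedekind := by
  have hle' : ∀ E : Submodule D K, s E ≤ s' E := by
    intro E
    by_cases hE : E = ⊥
    · rw [hE, s.map_bot]
      exact bot_le
    · exact hle E hE
  refine ⟨fun I hI => h.1 I fun n => ⟨(hI n).1, ?_⟩, ?_⟩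
  · exact le_antisymm (fun y hy => mem_of_isQuasiIdeal (hI n) (hle' _ hy)) (s.le_closure _)
  · rw [isPruferMD_iff]
    intro I hI hfg
    obtain ⟨F, hF, hFI, h1⟩ := s.isPruferMD_iff.mp h.2 I hI hfg
    exact ⟨F, hF, hFI, hle' _ h1⟩

theorem algebraMap_mem_coeSubmodule [IsFractionRing D K] {I : Ideal D} {y : D} :
    algebraMap D K y ∈ IsLocalization.coeSubmodule K I ↔ y ∈ I := by
  rw [IsLocalization.mem_coeSubmodule]
  refine ⟨?_, fun h => ⟨y, h, rfl⟩⟩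
  rintro ⟨z, hz, h⟩
  rwa [← IsFractionRing.injective D K h]

theorem exists_fg_coeSubmodule_eq [IsFractionRing D K] {F : Submodule D K} (hF : F.FG)
    (h : F ≤ 1) :
    ∃ G : Ideal D, G.FG ∧ IsLocalization.coeSubmodule K G = F := by
  have h' : IsLocalization.coeSubmodule K (F.comap (Algebra.linearMap D K)) = F := by
    refine Submodule.map_comap_eq_of_le ?_
    rwa [Submodule.one_eq_range] at h
  refine ⟨F.comap (Algebra.linearMap D K), ?_, h'⟩
  refine (IsLocalization.coeSubmodule_fg K (IsFractionRing.injective D K) _).mp ?_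
  rwa [h']

/-! ### Generation up to `⋆` in `⋆`-Dedekind domains -/

/-- In a `⋆`-Dedekind domain, membership in `I^⋆` is detected by multiplying with a finitely
generated ideal `G` with `G^⋆ = D^⋆`. If `F ⊆ I` is finitely generated with `y ∈ F^⋆` and
`F' = F + yD`, then `F F'⁻¹` multiplies `y` into `F`, and `(F F'⁻¹)^⋆ = (F' F'⁻¹)^⋆ = D^⋆`. -/
theorem IsDedekind.exists_fg_mul_mem [IsFractionRing D K] {s : SemistarOperation D K}
    (h : s.IsDedekind) {I : Ideal D} (hI : I ≠ ⊥) {y : D}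
    (hy : algebraMap D K y ∈ s (IsLocalization.coeSubmodule K I)) :
    ∃ G : Ideal D, G.FG ∧ (1 : K) ∈ s (IsLocalization.coeSubmodule K G) ∧ ∀ g ∈ G, y * g ∈ I := by
  obtain ⟨F, hF, hF0, hFI, hIF⟩ := h.1.exists_fg_le_star hI
  set F' : Ideal D := F ⊔ Ideal.span {y} with hF'
  obtain ⟨E, -, hE, h1⟩ := s.isPruferMD_iff.mp h.2 F' (ne_bot_of_le_ne_bot hF0 le_sup_left)
    (Submodule.FG.sup hF (Submodule.fg_span_singleton y))
  have hyF' : y ∈ F' := Ideal.mem_sup_right (Ideal.mem_span_singleton_self y)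
  have hF'F : IsLocalization.coeSubmodule K F' ≤ s (IsLocalization.coeSubmodule K F) := by
    rw [hF', IsLocalization.coeSubmodule_sup]
    refine sup_le (s.le_star _) ?_
    rw [IsLocalization.coeSubmodule_span_singleton, Submodule.span_singleton_le_iff_mem]
    exact s.star_le_star_of_le hIF hy
  let A : Ideal D := Submodule.comap (LinearMap.mulLeft D y) I
  have hA : IsLocalization.coeSubmodule K F * (1 / IsLocalization.coeSubmodule K F') ≤
      IsLocalization.coeSubmodule K A := by
    refine Submodule.mul_le.mpr ?_
    rintro _ ⟨f, hf, rfl⟩ c hc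
    rw [Submodule.mem_div_iff_forall_mul_mem] at hc
    obtain ⟨e, he⟩ := Submodule.mem_one.mp
      (hc _ (algebraMap_mem_coeSubmodule.mpr ((le_sup_left : F ≤ F') hf)))
    obtain ⟨e', he'⟩ := Submodule.mem_one.mp (hc _ (algebraMap_mem_coeSubmodule.mpr hyF'))
    refine ⟨e, ?_, ?_⟩
    · have : y * e = e' * f := by
        apply IsFractionRing.injective D K
        rw [map_mul, map_mul, he, he']
        ring
      change y * e ∈ I
      rw [this]
      exact I.mul_mem_left _ (hFI hf)
    · rw [Algebra.linearMap_apply, he, Algebra.linearMap_apply, mul_comm]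
  have h1A : (1 : K) ∈ s (IsLocalization.coeSubmodule K A) := by
    refine s.star_le_star_of_le ?_ h1
    exact hE.trans ((mul_le_mul_left hF'F _).trans ((s.star_mul_le _ _).trans
      (s.mono _ _ hA)))
  obtain ⟨G, hG, -, hGA, hAG⟩ := h.1.exists_fg_le_star (s.ne_bot_of_one_mem_star h1A)
  exact ⟨G, hG, s.star_le_star_of_le hAG h1A, fun g hg => hGA hg⟩

/-! ### Linked overrings -/

theorem coeSubmodule_map_le_iff {T : Subalgebra D K} {G : Ideal D} {E : Submodule T K} :
    IsLocalization.coeSubmodule K (G.map (algebraMap D T)) ≤ E ↔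
      ∀ g ∈ G, algebraMap D K g ∈ E := by
  rw [IsLocalization.coeSubmodule, Submodule.map_le_iff_le_comap]
  exact Ideal.map_le_iff_le_comap (K := E.comap (Algebra.linearMap T K))

theorem IsLinked.one_mem {s : SemistarOperation D K} {T : Subalgebra D K}
    {s' : SemistarOperation T K} (hl : s.IsLinked T s') {G : Ideal D} (hG : G.FG)
    (h1 : (1 : K) ∈ s (IsLocalization.coeSubmodule K G)) :
    (1 : K) ∈ s' (IsLocalization.coeSubmodule K (G.map (algebraMap D T))) :=
  (s'.star_eq_star_one_iff (coeSubmodule_le_one _)).mp <|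
    hl G (s.ne_bot_of_one_mem_star h1) hG
      ((s.star_eq_star_one_iff (coeSubmodule_le_one _)).mpr h1)

theorem isLinked_dot (s : SemistarOperation D K) : s.IsLinked s.overring s.dot := by
  intro F _ _ h
  rw [star_eq_star_one_iff _ (coeSubmodule_le_one _)] at h ⊢
  refine s.mono _ _ ?_ h
  rintro _ ⟨y, hy, rfl⟩
  exact ⟨algebraMap D s.overring y, Ideal.mem_map_of_mem _ hy, rfl⟩

/-! ### Prime quasi-`⋆`-ideals -/

theorem exists_notMem_of_one_mem_star {s : SemistarOperation D K} {P G : Ideal D} (hP : P.IsPrime)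
    (hq : s.IsQuasiIdeal P) (h1 : (1 : K) ∈ s (IsLocalization.coeSubmodule K G)) :
    ∃ u ∈ G, u ∉ P := by
  by_contra! hGP
  refine hP.ne_top ((Ideal.eq_top_iff_one P).mpr (mem_of_isQuasiIdeal hq ?_))
  rw [map_one]
  exact s.mono _ _ (Submodule.map_mono hGP) h1

/-- Noetherian induction: if `I` is neither `D` nor prime, and `a b ∈ I` with `a, b ∉ I`, every
prime quasi-`⋆`-ideal over `I` lies over `(I + aD)^⋆ ∩ D` or `(I + bD)^⋆ ∩ D`. -/
theorem IsNoetherian.exists_finite_primes {s : SemistarOperation D K} (h : s.IsNoetherian)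
    (I : {I : Ideal D // s.IsQuasiIdeal I}) :
    ∃ Z : Set (Ideal D), Z.Finite ∧ (∀ Q ∈ Z, Q.IsPrime ∧ s.IsQuasiIdeal Q) ∧
      ∀ P : Ideal D, P.IsPrime → s.IsQuasiIdeal P → I.1 ≤ P → ∃ Q ∈ Z, Q ≤ P := by
  have := h.wellFoundedGT
  induction I using WellFoundedGT.induction with
  | ind I ih =>
  obtain ⟨I, hI⟩ := I
  by_cases htop : I = ⊤
  · exact ⟨∅, Set.finite_empty, by simp, fun P hP _ hle =>
      absurd (top_le_iff.mp (htop ▸ hle)) hP.ne_top⟩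
  by_cases hprime : I.IsPrime
  · exact ⟨{I}, Set.finite_singleton I, by simp [hprime, hI], fun P _ _ hle => ⟨I, rfl, hle⟩⟩
  obtain ⟨a, ha, b, hb, hab⟩ := (Ideal.not_isPrime_iff.mp hprime).resolve_left htop
  have step : ∀ a ∉ I, ∃ Z : Set (Ideal D), Z.Finite ∧ (∀ Q ∈ Z, Q.IsPrime ∧ s.IsQuasiIdeal Q) ∧
      ∀ P : Ideal D, P.IsPrime → s.IsQuasiIdeal P → I ≤ P → a ∈ P → ∃ Q ∈ Z, Q ≤ P := by
    intro a ha
    have h0 : I ⊔ Ideal.span {a} ≠ ⊥ := ne_bot_of_le_ne_bot hI.1 le_sup_left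
    obtain ⟨Z, hZ, hZp, hZP⟩ := ih ⟨s.closure (I ⊔ Ideal.span {a}), s.isQuasiIdeal_closure h0⟩
      (lt_of_le_not_ge (le_sup_left.trans (s.le_closure _)) fun hle => ha (hle (s.le_closure _
        (Ideal.mem_sup_right (Ideal.mem_span_singleton_self a)))))
    refine ⟨Z, hZ, hZp, fun P hP hq hIP haP => hZP P hP hq (closure_le_of_isQuasiIdeal hq ?_)⟩
    exact sup_le hIP ((Ideal.span_singleton_le_iff_mem P).mpr haP)
  obtain ⟨Z₁, hZ₁, hp₁, h₁⟩ := step a ha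
  obtain ⟨Z₂, hZ₂, hp₂, h₂⟩ := step b hb
  refine ⟨Z₁ ∪ Z₂, hZ₁.union hZ₂, fun Q hQ => hQ.elim (hp₁ Q) (hp₂ Q), fun P hP hq hIP => ?_⟩
  rcases hP.mem_or_mem (hIP hab) with haP | hbP
  · obtain ⟨Q, hQ, hle⟩ := h₁ P hP hq hIP haP
    exact ⟨Q, Or.inl hQ, hle⟩
  · obtain ⟨Q, hQ, hle⟩ := h₂ P hP hq hIP hbP
    exact ⟨Q, Or.inr hQ, hle⟩

/-- The prime is a maximal element among the proper quasi-`⋆`-ideals that contain `I`. -/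
theorem IsNoetherian.exists_le_prime {s : SemistarOperation D K} (h : s.IsNoetherian)
    {I : Ideal D} (hI : s.IsQuasiIdeal I) (htop : I ≠ ⊤) :
    ∃ P : Ideal D, P.IsPrime ∧ s.IsQuasiIdeal P ∧ I ≤ P := by
  have := h.wellFoundedGT
  obtain ⟨⟨P, hP⟩, ⟨hIP, hPtop⟩, hmax⟩ := WellFounded.has_min
    (wellFounded_gt (α := {I : Ideal D // s.IsQuasiIdeal I})) {Q | I ≤ Q.1 ∧ Q.1 ≠ ⊤}
    ⟨⟨I, hI⟩, le_rfl, htop⟩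
  refine ⟨P, ⟨hPtop, ?_⟩, hP, hIP⟩
  intro a b hab
  by_contra! hne
  have h0 : P ⊔ Ideal.span {a} ≠ ⊥ := ne_bot_of_le_ne_bot hP.1 le_sup_left
  have hPle : P ≤ s.closure (P ⊔ Ideal.span {a}) := le_sup_left.trans (s.le_closure _)
  refine hmax ⟨s.closure (P ⊔ Ideal.span {a}), s.isQuasiIdeal_closure h0⟩ ⟨hIP.trans hPle, ?_⟩
    (lt_of_le_not_ge hPle fun hle => hne.1 (hle (s.le_closure _
      (Ideal.mem_sup_right (Ideal.mem_span_singleton_self a)))))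
  intro h1
  -- `1 ∈ (P + aD)^⋆` and `b (P + aD) ⊆ P`, so `b ∈ P^⋆`
  rw [Ideal.eq_top_iff_one, mem_closure, map_one] at h1
  refine hne.2 (mem_of_isQuasiIdeal hP ?_)
  rw [← mul_one (algebraMap D K b)]
  refine s.mul_mem_star ?_ h1
  rintro _ ⟨z, hz, rfl⟩
  refine ⟨b * z, ?_, by simp⟩
  obtain ⟨p, hp, q, hq, rfl⟩ := Submodule.mem_sup.mp hz
  obtain ⟨e, rfl⟩ := Ideal.mem_span_singleton'.mp hq
  rw [mul_add, show b * (e * a) = e * (a * b) by ring]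
  exact add_mem (P.mul_mem_left _ hp) (P.mul_mem_left _ hab)

end Semistar

/-! ### Dedekind domains and the Prüfer condition for arbitrary elements of `K` -/

section Domain

variable {D K : Type*} [CommRing D] [IsDomain D] [Field K] [Algebra D K] [IsFractionRing D K]

theorem isDedekind_of_isDedekindDomain (hD : IsDedekindDomain D) (s : SemistarOperation D K) :
    s.IsDedekind := by
  refine ⟨fun I _ => monotone_stabilizes_iff_noetherian.mpr inferInstance I, ?_⟩
  intro I hI _
  have h : IsLocalization.coeSubmodule K I * (1 / IsLocalization.coeSubmodule K I) = 1 := by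
    have hI' : (I : FractionalIdeal (nonZeroDivisors D) K) ≠ 0 :=
      FractionalIdeal.coeIdeal_ne_zero.mpr hI
    have h2 := congrArg (fun J : FractionalIdeal (nonZeroDivisors D) K => (J : Submodule D K))
      (mul_inv_cancel₀ hI')
    simpa [FractionalIdeal.coe_mul, FractionalIdeal.coe_inv_of_ne_zero K hI'] using h2
  rw [IsInvertible, h]

/-- The Prüfer condition for the fractional ideal `A = D + xD`: some finitely generated `G` with
`G^⋆ = D^⋆` is contained in `A A⁻¹ = A⁻¹ + x A⁻¹`, where `A⁻¹ = {a ∈ D | x a ∈ D}`. -/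
theorem IsPruferMD.exists_fg_denominator {s : SemistarOperation D K} (h : s.IsPruferMD) (x : K) :
    ∃ G : Ideal D, G.FG ∧ (1 : K) ∈ s (IsLocalization.coeSubmodule K G) ∧
      ∀ g ∈ G, ∃ a b c d : D, x * algebraMap D K a = algebraMap D K c ∧
        x * algebraMap D K b = algebraMap D K d ∧ g = a + d := by
  obtain ⟨p, q, hq, rfl⟩ := IsFractionRing.div_surjective (A := D) x
  have hq0 : q ≠ 0 := nonZeroDivisors.ne_zero hq
  have hqK : algebraMap D K q ≠ 0 := by
    rwa [Ne, FaithfulSMul.algebraMap_eq_zero_iff]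
  have hpI : p ∈ Ideal.span {p, q} := Ideal.subset_span (by simp)
  have hqI : q ∈ Ideal.span {p, q} := Ideal.subset_span (by simp)
  obtain ⟨E, hE, hEI, h1⟩ := s.isPruferMD_iff.mp h (Ideal.span {p, q})
    (fun h0 => hq0 (by rw [h0] at hqI; exact hqI)) (Submodule.fg_span (by simp))
  obtain ⟨G, hG, rfl⟩ := exists_fg_coeSubmodule_eq hE (hEI.trans Submodule.mul_one_div_le_one)
  refine ⟨G, hG, h1, fun g hg => ?_⟩
  have hg' := hEI (algebraMap_mem_coeSubmodule.mpr hg)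
  suffices ∀ z ∈ IsLocalization.coeSubmodule K (Ideal.span {p, q}) *
      (1 / IsLocalization.coeSubmodule K (Ideal.span {p, q})), ∃ a b c d : D,
      algebraMap D K p / algebraMap D K q * algebraMap D K a = algebraMap D K c ∧
      algebraMap D K p / algebraMap D K q * algebraMap D K b = algebraMap D K d ∧
      z = algebraMap D K (a + d) by
    obtain ⟨a, b, c, d, h1, h2, h3⟩ := this _ hg'
    exact ⟨a, b, c, d, h1, h2, IsFractionRing.injective D K h3⟩
  intro z hz
  induction hz using Submodule.mul_induction_on' with
  | mem_mul_mem i hi t ht =>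
    obtain ⟨i, hi, rfl⟩ := hi
    obtain ⟨α, β, rfl⟩ := Ideal.mem_span_pair.mp hi
    rw [Submodule.mem_div_iff_forall_mul_mem] at ht
    obtain ⟨e, he⟩ := Submodule.mem_one.mp (ht _ (algebraMap_mem_coeSubmodule.mpr hpI))
    obtain ⟨f, hf⟩ := Submodule.mem_one.mp (ht _ (algebraMap_mem_coeSubmodule.mpr hqI))
    refine ⟨β * f, α * f, β * e, α * e, ?_, ?_, ?_⟩
    · rw [map_mul, map_mul, he, hf]
      field_simp
    · rw [map_mul, map_mul, he, hf]
      field_simp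
    · simp only [Algebra.linearMap_apply, map_add, map_mul, he, hf]
      ring
  | add z₁ _ z₂ _ h₁ h₂ =>
    obtain ⟨a₁, b₁, c₁, d₁, h₁, h₁', rfl⟩ := h₁
    obtain ⟨a₂, b₂, c₂, d₂, h₂, h₂', rfl⟩ := h₂
    refine ⟨a₁ + a₂, b₁ + b₂, c₁ + c₂, d₁ + d₂, ?_, ?_, ?_⟩
    · rw [map_add, map_add, mul_add, h₁, h₂]
    · rw [map_add, map_add, mul_add, h₁', h₂']
    · simp only [map_add]
      ring

/-! ### Ascent to linked overrings -/

theorem IsPruferMD.of_isLinked {s : SemistarOperation D K} {T : Subalgebra D K}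
    {s' : SemistarOperation T K} (hl : s.IsLinked T s') (h : s.IsPruferMD) : s'.IsPruferMD := by
  classical
  rw [isPruferMD_iff]
  rintro J hJ ⟨S, rfl⟩
  obtain ⟨⟨d, hd⟩, hdS⟩ := IsLocalization.exist_integer_multiples_of_finset (nonZeroDivisors D)
    (S.image fun t : T => (t : K))
  have hd0 : algebraMap D K d ≠ 0 := by
    rw [Ne, FaithfulSMul.algebraMap_eq_zero_iff]
    exact nonZeroDivisors.ne_zero hd
  have hdS' : ∀ t ∈ S, ∃ e : D, algebraMap D K e = algebraMap D K d * (t : K) := by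
    intro t ht
    obtain ⟨e, he⟩ := hdS t (Finset.mem_image_of_mem _ ht)
    exact ⟨e, by rw [he, Algebra.smul_def]⟩
  choose! f hf using hdS'
  let I : Ideal D := Ideal.span (S.image f : Finset D)
  have hfI : ∀ t ∈ S, f t ∈ I := fun t ht =>
    Ideal.subset_span (Finset.mem_coe.mpr (Finset.mem_image_of_mem f ht))
  have hI : I ≠ ⊥ := by
    intro hI
    apply hJ
    rw [Submodule.span_eq_bot]
    intro t ht
    have h0 : f t = 0 := by
      have := hfI t ht
      rwa [hI] at this
    have h2 := hf t ht
    rw [h0, map_zero] at h2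
    exact Subtype.ext ((mul_eq_zero.mp h2.symm).resolve_left hd0)
  obtain ⟨E, hE, hEI, h1⟩ := s.isPruferMD_iff.mp h I hI ⟨_, rfl⟩
  obtain ⟨G, hG, rfl⟩ := exists_fg_coeSubmodule_eq hE (hEI.trans Submodule.mul_one_div_le_one)
  refine ⟨_, Submodule.FG.map _ (Ideal.FG.map hG _), ?_, hl.one_mem hG h1⟩
  refine coeSubmodule_map_le_iff.mpr ?_
  intro g hg
  suffices ∀ z ∈ IsLocalization.coeSubmodule K I * (1 / IsLocalization.coeSubmodule K I),
      z ∈ IsLocalization.coeSubmodule K (Submodule.span T (S : Set T)) *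
        (1 / IsLocalization.coeSubmodule K (Submodule.span T (S : Set T))) from
    this _ (hEI (algebraMap_mem_coeSubmodule.mpr hg))
  intro z hz
  induction hz using Submodule.mul_induction_on' with
  | mem_mul_mem i hi c hc =>
    obtain ⟨i, hi, rfl⟩ := hi
    rw [Submodule.mem_div_iff_forall_mul_mem] at hc
    -- `i c = (d⁻¹ i) (d c)`, with `d⁻¹ i ∈ J` and `d c ∈ J⁻¹`
    have hiJ : (algebraMap D K d)⁻¹ * algebraMap D K i ∈
        IsLocalization.coeSubmodule K (Submodule.span T (S : Set T)) := by
      induction hi using Submodule.span_induction with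
      | mem i hi =>
        obtain ⟨t, ht, rfl⟩ := Finset.mem_image.mp (Finset.mem_coe.mp hi)
        refine ⟨t, Submodule.subset_span ht, ?_⟩
        rw [hf t ht, inv_mul_cancel_left₀ hd0]
        rfl
      | zero => simp
      | add i j _ _ hi hj =>
        rw [map_add, mul_add]
        exact add_mem hi hj
      | smul r i _ hi =>
        rw [smul_eq_mul, map_mul, mul_left_comm]
        exact Submodule.smul_mem _ (algebraMap D T r) hi
    have hcJ : algebraMap D K d * c ∈
        1 / IsLocalization.coeSubmodule K (Submodule.span T (S : Set T)) := by
      rw [Submodule.mem_div_iff_forall_mul_mem]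
      rintro _ ⟨j, hj, rfl⟩
      induction hj using Submodule.span_induction with
      | mem t ht =>
        obtain ⟨e, he⟩ := Submodule.mem_one.mp
          (hc _ (algebraMap_mem_coeSubmodule.mpr (hfI t ht)))
        refine Submodule.mem_one.mpr ⟨algebraMap D T e, ?_⟩
        rw [← IsScalarTower.algebraMap_apply D T K, he, hf t ht, ← mul_assoc,
          mul_comm c (algebraMap D K d)]
        rfl
      | zero => simp
      | add i j _ _ hi hj =>
        rw [map_add, mul_add]
        exact add_mem hi hj
      | smul r i _ hi =>
        rw [LinearMap.map_smul, mul_smul_comm]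
        exact Submodule.smul_mem _ r hi
    have := Submodule.mul_mem_mul hiJ hcJ
    convert this using 1
    rw [Algebra.linearMap_apply]
    field_simp
  | add z₁ _ z₂ _ h₁ h₂ => exact add_mem h₁ h₂

/-- The contraction to `D` of a quasi-`⋆'`-ideal of a linked overring is a quasi-`⋆`-ideal. -/
theorem IsDedekind.isQuasiIdeal_comap {s : SemistarOperation D K} {T : Subalgebra D K}
    {s' : SemistarOperation T K} (hl : s.IsLinked T s') (h : s.IsDedekind) {J : Ideal T}
    (hJ : s'.IsQuasiIdeal J) : s.IsQuasiIdeal (J.comap (algebraMap D T)) := by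
  have h0 : J.comap (algebraMap D T) ≠ ⊥ := by
    obtain ⟨t, ht, ht0⟩ := Submodule.exists_mem_ne_zero_of_ne_bot hJ.1
    obtain ⟨p, q, hq, hpq⟩ := IsFractionRing.div_surjective (A := D) (t : K)
    have hqK : algebraMap D K q ≠ 0 := by
      rw [Ne, FaithfulSMul.algebraMap_eq_zero_iff]
      exact nonZeroDivisors.ne_zero hq
    have hp : algebraMap D T p = algebraMap D T q * t := by
      apply Subtype.ext
      change algebraMap D K p = algebraMap D K q * (t : K)
      rw [← hpq]
      field_simp
    intro hbot
    have hpJ : p ∈ J.comap (algebraMap D T) := by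
      rw [Ideal.mem_comap, hp]
      exact J.mul_mem_left _ ht
    rw [hbot, Ideal.mem_bot] at hpJ
    apply ht0
    apply Subtype.ext
    rw [← hpq, hpJ]
    simp
  refine ⟨h0, le_antisymm (fun y hy => ?_) (s.le_closure _)⟩
  obtain ⟨G, hG, h1, hyG⟩ := h.exists_fg_mul_mem h0 hy
  refine mem_of_isQuasiIdeal hJ ?_
  rw [← mul_one (algebraMap T K _)]
  refine s'.mul_mem_star (fun z hz => ?_) (hl.one_mem hG h1)
  have hle : IsLocalization.coeSubmodule K (G.map (algebraMap D T)) ≤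
      (IsLocalization.coeSubmodule K J).comap
        (LinearMap.mulLeft T (algebraMap T K (algebraMap D T y))) := by
    rw [coeSubmodule_map_le_iff]
    intro g hg
    exact ⟨algebraMap D T (y * g), hyG g hg, by simp⟩
  exact hle hz

/-- Every element of an ideal `J` of a linked overring `T` lies in `((J ∩ D) T)^⋆'`: for `x ∈ J`,
the ideal `G` of `IsPruferMD.exists_fg_denominator` satisfies `x G ⊆ (J ∩ D) T`. -/
theorem IsPruferMD.mem_star_map_comap {s : SemistarOperation D K} {T : Subalgebra D K}
    {s' : SemistarOperation T K} (hl : s.IsLinked T s') (h : s.IsPruferMD) {J : Ideal T} {x : T}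
    (hx : x ∈ J) : x ∈ s'.closure ((J.comap (algebraMap D T)).map (algebraMap D T)) := by
  obtain ⟨G, hG, h1, hxG⟩ := h.exists_fg_denominator (x : K)
  rw [mem_closure, ← mul_one (algebraMap T K x)]
  refine s'.mul_mem_star (fun z hz => ?_) (hl.one_mem hG h1)
  have hle : IsLocalization.coeSubmodule K (G.map (algebraMap D T)) ≤
      (IsLocalization.coeSubmodule K ((J.comap (algebraMap D T)).map (algebraMap D T))).comap
        (LinearMap.mulLeft T (algebraMap T K x)) := by
    rw [coeSubmodule_map_le_iff]
    intro g hg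
    obtain ⟨a, b, c, d, hc, hd, rfl⟩ := hxG g hg
    have hmem : ∀ a c : D, (x : K) * algebraMap D K a = algebraMap D K c →
        c ∈ J.comap (algebraMap D T) := by
      intro a c hac
      have : algebraMap D T c = x * algebraMap D T a := Subtype.ext hac.symm
      rw [Ideal.mem_comap, this]
      exact J.mul_mem_right _ hx
    refine ⟨algebraMap D T c + x * algebraMap D T d, add_mem (Ideal.mem_map_of_mem _ (hmem a c hc))
      (Ideal.mul_mem_left _ _ (Ideal.mem_map_of_mem _ (hmem b d hd))), ?_⟩
    change algebraMap D K c + (x : K) * algebraMap D K d = (x : K) * algebraMap D K (a + d)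
    rw [map_add, mul_add, hc]
  exact hle hz

theorem IsDedekind.of_isLinked {s : SemistarOperation D K} {T : Subalgebra D K}
    {s' : SemistarOperation T K} (hl : s.IsLinked T s') (h : s.IsDedekind) : s'.IsDedekind := by
  refine ⟨fun J hJ => ?_, h.2.of_isLinked hl⟩
  obtain ⟨n, hn⟩ := h.1 ⟨fun k => (J k).comap (algebraMap D T),
    fun _ _ hij => Ideal.comap_mono (J.2 hij)⟩ fun k => h.isQuasiIdeal_comap hl (hJ k)
  refine ⟨n, fun m hm => le_antisymm (J.2 hm) fun x hx => ?_⟩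
  refine closure_le_of_isQuasiIdeal (hJ n) ?_ (h.2.mem_star_map_comap hl hx)
  rw [← show (J n).comap (algebraMap D T) = (J m).comap (algebraMap D T) from hn m hm]
  exact Ideal.map_comap_le

/-! ### Localizations at prime quasi-`⋆`-ideals and the Krull property -/

/-- The localization `D_P` inside `K`, for a prime quasi-`⋆`-ideal `P` of a Prüfer
`⋆`-multiplication domain, as a valuation subring: its elements are the `x` with `u x ∈ D` for
some `u ∈ D ∖ P`. -/
def localization {s : SemistarOperation D K} (h : s.IsPruferMD) {P : Ideal D} (hP : P.IsPrime)
    (hq : s.IsQuasiIdeal P) : ValuationSubring K where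
  carrier := {x | ∃ u c : D, u ∉ P ∧ x * algebraMap D K u = algebraMap D K c}
  zero_mem' := ⟨1, 0, (Ideal.ne_top_iff_one P).mp hP.ne_top, by simp⟩
  one_mem' := ⟨1, 1, (Ideal.ne_top_iff_one P).mp hP.ne_top, by simp⟩
  mul_mem' := by
    rintro x y ⟨u, c, hu, hc⟩ ⟨v, d, hv, hd⟩
    refine ⟨u * v, c * d, hP.mul_notMem hu hv, ?_⟩
    rw [map_mul, map_mul, ← hc, ← hd]
    ring
  add_mem' := by
    rintro x y ⟨u, c, hu, hc⟩ ⟨v, d, hv, hd⟩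
    refine ⟨u * v, c * v + d * u, hP.mul_notMem hu hv, ?_⟩
    rw [map_mul, map_add, map_mul, map_mul, ← hc, ← hd]
    ring
  neg_mem' := by
    rintro x ⟨u, c, hu, hc⟩
    exact ⟨u, -c, hu, by rw [map_neg, ← hc, neg_mul]⟩
  mem_or_inv_mem' := by
    intro x
    by_cases hx : x = 0
    · exact Or.inl ⟨1, 0, (Ideal.ne_top_iff_one P).mp hP.ne_top, by simp [hx]⟩
    obtain ⟨G, _, h1, hxG⟩ := h.exists_fg_denominator x
    obtain ⟨u, hu, huP⟩ := exists_notMem_of_one_mem_star hP hq h1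
    obtain ⟨a, b, c, d, hc, hd, rfl⟩ := hxG u hu
    by_cases ha : a ∈ P
    · exact Or.inr ⟨d, b, fun hdP => huP (add_mem ha hdP), by rw [← hd]; field_simp⟩
    · exact Or.inl ⟨a, c, ha, hc⟩

theorem algebraMap_mem_localization {s : SemistarOperation D K} (h : s.IsPruferMD) {P : Ideal D}
    (hP : P.IsPrime) (hq : s.IsQuasiIdeal P) (d : D) :
    algebraMap D K d ∈ localization h hP hq :=
  ⟨1, d, (Ideal.ne_top_iff_one P).mp hP.ne_top, by simp⟩

theorem inv_mem_localization_iff {s : SemistarOperation D K} (h : s.IsPruferMD) {P : Ideal D}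
    (hP : P.IsPrime) (hq : s.IsQuasiIdeal P) {d : D} (hd : d ≠ 0) :
    (algebraMap D K d)⁻¹ ∈ localization h hP hq ↔ d ∉ P := by
  have hd' : algebraMap D K d ≠ 0 := by
    rwa [Ne, FaithfulSMul.algebraMap_eq_zero_iff]
  constructor
  · rintro ⟨u, c, hu, hc⟩ hdP
    rw [inv_mul_eq_iff_eq_mul₀ hd', ← map_mul] at hc
    rw [IsFractionRing.injective D K hc] at hu
    exact hu (P.mul_mem_right _ hdP)
  · intro hdP
    exact ⟨d, 1, hdP, by rw [inv_mul_cancel₀ hd', map_one]⟩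

theorem valuation_localization_eq_one_iff {s : SemistarOperation D K} (h : s.IsPruferMD)
    {P : Ideal D} (hP : P.IsPrime) (hq : s.IsQuasiIdeal P) {d : D} (hd : d ≠ 0) :
    (localization h hP hq).valuation (algebraMap D K d) = 1 ↔ d ∉ P := by
  have hd' : algebraMap D K d ≠ 0 := by
    rwa [Ne, FaithfulSMul.algebraMap_eq_zero_iff]
  rw [← inv_mem_localization_iff h hP hq hd, ← ValuationSubring.valuation_le_one_iff, map_inv₀]
  have h1 := (ValuationSubring.valuation_le_one_iff _ _).mpr
    (algebraMap_mem_localization h hP hq d)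
  have h0 : 0 < (localization h hP hq).valuation (algebraMap D K d) :=
    zero_lt_iff.mpr ((Valuation.ne_zero_iff _).mpr hd')
  rw [inv_le_one₀ h0]
  exact ⟨fun h => h.ge, fun h => le_antisymm h1 h⟩

/-- `D_P` is Noetherian because an ideal of `D_P` is generated by any finitely generated ideal `F`
of `D` with the same `⋆`-closure as its contraction to `D`. -/
theorem IsDedekind.isDiscreteValuationRing {s : SemistarOperation D K} (h : s.IsDedekind)
    {P : Ideal D} (hP : P.IsPrime) (hq : s.IsQuasiIdeal P) :
    IsDiscreteValuationRing (localization h.2 hP hq) := by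
  set V := localization h.2 hP hq with hV
  let φ : D →+* V := (algebraMap D K).codRestrict V.toSubring
    (algebraMap_mem_localization h.2 hP hq)
  have hφ : ∀ d, ((φ d : V) : K) = algebraMap D K d := fun _ => rfl
  have hunit : ∀ u : D, u ∉ P → IsUnit (φ u) := by
    intro u hu
    have hu0 : u ≠ 0 := by
      rintro rfl
      exact hu P.zero_mem
    refine IsUnit.of_mul_eq_one ⟨_, (inv_mem_localization_iff h.2 hP hq hu0).mpr hu⟩ ?_
    apply Subtype.ext
    change algebraMap D K u * (algebraMap D K u)⁻¹ = 1
    exact mul_inv_cancel₀ (by rwa [Ne, FaithfulSMul.algebraMap_eq_zero_iff])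
  have hnoeth : IsNoetherianRing V := by
    rw [isNoetherianRing_iff_ideal_fg]
    intro N
    by_cases hN : N.comap φ = ⊥
    · have : N = ⊥ := by
        rw [eq_bot_iff]
        rintro ⟨x, u, c, hu, hc⟩ hx
        have hc' : φ c ∈ N := by
          rw [show φ c = ⟨x, u, c, hu, hc⟩ * φ u from Subtype.ext hc.symm]
          exact N.mul_mem_right _ hx
        have hc0 : c ∈ N.comap φ := hc'
        rw [hN, Ideal.mem_bot] at hc0
        rw [hc0, map_zero] at hc
        refine Subtype.ext ((mul_eq_zero.mp hc).resolve_right ?_)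
        rw [FaithfulSMul.algebraMap_eq_zero_iff]
        rintro rfl
        exact hu P.zero_mem
      rw [this]
      exact Submodule.fg_bot
    obtain ⟨F, hF, hF0, hFN, hNF⟩ := h.1.exists_fg_le_star hN
    suffices N = F.map φ by
      rw [this]
      exact Ideal.FG.map hF φ
    refine le_antisymm ?_ (Ideal.map_le_iff_le_comap.mpr hFN)
    rintro ⟨x, u, c, hu, hc⟩ hx
    have hcx : φ c = ⟨x, u, c, hu, hc⟩ * φ u := Subtype.ext hc.symm
    have hc' : c ∈ N.comap φ := by
      rw [Ideal.mem_comap, hcx]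
      exact N.mul_mem_right _ hx
    obtain ⟨G, _, h1, hG⟩ := h.exists_fg_mul_mem hF0 (hNF (algebraMap_mem_coeSubmodule.mpr hc'))
    obtain ⟨v, hvG, hvP⟩ := exists_notMem_of_one_mem_star hP hq h1
    have hmem := Ideal.mem_map_of_mem φ (hG v hvG)
    rwa [map_mul, hcx, mul_assoc, Ideal.mul_unit_mem_iff_mem _ ((hunit u hu).mul (hunit v hvP))]
      at hmem
  have hpir : IsPrincipalIdealRing V := (IsBezout.TFAE.out 0 1).mp hnoeth
  refine { not_a_field' := fun hbot => ?_ }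
  obtain ⟨p, hp, hp0⟩ := Submodule.exists_mem_ne_zero_of_ne_bot hq.1
  have hpV : φ p ∈ IsLocalRing.maximalIdeal V := by
    rw [IsLocalRing.mem_maximalIdeal, mem_nonunits_iff, isUnit_iff_exists_inv]
    rintro ⟨y, hy⟩
    refine (inv_mem_localization_iff h.2 hP hq hp0).not_left.mpr hp ?_
    have hy' : algebraMap D K p * (y : K) = 1 := congrArg Subtype.val hy
    rw [← eq_inv_of_mul_eq_one_right hy']
    exact y.2
  rw [hbot, Ideal.mem_bot] at hpV
  have := congrArg Subtype.val hpV
  rw [hφ] at this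
  exact hp0 ((FaithfulSMul.algebraMap_eq_zero_iff D K).mp this)

/-- Prime quasi-`⋆`-ideals are pairwise incomparable: if `0 ≠ r ∈ Q ⊊ P` and `y ∈ P ∖ Q`, then in
the discrete valuation ring `D_P` some power of `y` is divisible by `r`, so that
`yⁿ u ∈ Q` for some `u ∉ P`. -/
theorem IsDedekind.eq_of_le {s : SemistarOperation D K} (h : s.IsDedekind) {P Q : Ideal D}
    (hP : P.IsPrime) (hPq : s.IsQuasiIdeal P) (hQ : Q.IsPrime) (hQ0 : Q ≠ ⊥) (hle : Q ≤ P) :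
    Q = P := by
  refine le_antisymm hle fun y hy => ?_
  obtain ⟨r, hr, hr0⟩ := Submodule.exists_mem_ne_zero_of_ne_bot hQ0
  by_cases hy0 : y = 0
  · rw [hy0]
    exact Q.zero_mem
  have := h.isDiscreteValuationRing hP hPq
  set V := localization h.2 hP hPq with hV
  let r' : V := ⟨algebraMap D K r, algebraMap_mem_localization h.2 hP hPq r⟩
  let y' : V := ⟨algebraMap D K y, algebraMap_mem_localization h.2 hP hPq y⟩
  have hr' : r' ≠ 0 := fun h0 =>
    hr0 ((FaithfulSMul.algebraMap_eq_zero_iff D K).mp (congrArg Subtype.val h0))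
  have hy' : y' ∈ IsLocalRing.maximalIdeal V := by
    rw [IsLocalRing.mem_maximalIdeal, mem_nonunits_iff, isUnit_iff_exists_inv]
    rintro ⟨z, hz⟩
    refine (inv_mem_localization_iff h.2 hP hPq hy0).not_left.mpr hy ?_
    rw [← eq_inv_of_mul_eq_one_right (congrArg Subtype.val hz)]
    exact z.2
  obtain ⟨ϖ, hϖ⟩ := IsDiscreteValuationRing.exists_irreducible V
  obtain ⟨n, w, hw⟩ := IsDiscreteValuationRing.eq_unit_mul_pow_irreducible hr' hϖ
  have hdvd : r' ∣ y' ^ n := by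
    rw [(IsDiscreteValuationRing.irreducible_iff_uniformizer ϖ).mp hϖ,
      Ideal.mem_span_singleton] at hy'
    rw [hw, Units.mul_left_dvd]
    exact pow_dvd_pow_of_dvd hy' n
  obtain ⟨⟨z, u, c, hu, hc⟩, hz⟩ := hdvd
  have hz' : algebraMap D K y ^ n = algebraMap D K r * z := congrArg Subtype.val hz
  have hmem : y ^ n * u = r * c := by
    apply IsFractionRing.injective D K
    rw [map_mul, map_mul, map_pow, hz', ← hc, mul_assoc]
  have hQmem : y ^ n * u ∈ Q := hmem ▸ Q.mul_mem_right _ hr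
  exact hQ.mem_of_pow_mem n ((hQ.mem_or_mem hQmem).resolve_right fun huQ => hu (hle huQ))

theorem IsDedekind.finite_primes_mem {s : SemistarOperation D K} (h : s.IsDedekind) {d : D}
    (hd : d ≠ 0) :
    {P : Ideal D | P.IsPrime ∧ s.IsQuasiIdeal P ∧ d ∈ P}.Finite := by
  have hd' : Ideal.span {d} ≠ ⊥ := by simpa [Ideal.span_singleton_eq_bot] using hd
  obtain ⟨Z, hZ, hZp, hZP⟩ := h.1.exists_finite_primes
    ⟨s.closure (Ideal.span {d}), s.isQuasiIdeal_closure hd'⟩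
  refine hZ.subset ?_
  rintro P ⟨hP, hq, hdP⟩
  obtain ⟨Q, hQ, hQP⟩ := hZP P hP hq (closure_le_of_isQuasiIdeal hq
    ((Ideal.span_singleton_le_iff_mem P).mpr hdP))
  rwa [← h.eq_of_le hP hq (hZp Q hQ).1 (hZp Q hQ).2.1 hQP]

theorem IsDedekind.isKrullDomain {s : SemistarOperation D K} (hs : s.IsSemiStar)
    (h : s.IsDedekind) : IsKrullDomain D K := by
  refine ⟨{V | ∃ (P : Ideal D) (hP : P.IsPrime) (hq : s.IsQuasiIdeal P),
    V = localization h.2 hP hq}, ?_, fun x => ⟨?_, fun hx => ?_⟩, fun x hx => ?_⟩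
  · rintro _ ⟨P, hP, hq, rfl⟩
    exact h.isDiscreteValuationRing hP hq
  · rintro ⟨d, rfl⟩ _ ⟨P, hP, hq, rfl⟩
    exact algebraMap_mem_localization h.2 hP hq d
  · -- the ideal `(D : x)` is a quasi-`⋆`-ideal because `D^⋆ = D`
    let A : Ideal D := (1 : Submodule D K).comap (LinearMap.toSpanSingleton D K x)
    have hA : ∀ {d : D}, d ∈ A ↔ ∃ c, algebraMap D K c = x * algebraMap D K d := by
      intro d
      rw [Submodule.mem_comap, LinearMap.toSpanSingleton_apply, Submodule.mem_one,
        Algebra.smul_def, mul_comm]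
    have hAq : s.IsQuasiIdeal A := by
      constructor
      · obtain ⟨p, q, hq, rfl⟩ := IsFractionRing.div_surjective (A := D) x
        have hq0 : q ≠ 0 := nonZeroDivisors.ne_zero hq
        have hqK : algebraMap D K q ≠ 0 := by
          rwa [Ne, FaithfulSMul.algebraMap_eq_zero_iff]
        refine (Submodule.ne_bot_iff _).mpr ⟨q, hA.mpr ⟨p, ?_⟩, hq0⟩
        field_simp
      · refine le_antisymm (fun y hy => hA.mpr ?_) (s.le_closure A)
        rw [← Submodule.mem_one, ← hs]
        refine s.mul_mem_star ?_ hy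
        rintro _ ⟨z, hz, rfl⟩
        exact Submodule.mem_one.mpr (hA.mp hz)
    by_contra hxD
    have hAtop : A ≠ ⊤ := by
      rw [Ideal.ne_top_iff_one, hA]
      rintro ⟨c, hc⟩
      exact hxD ⟨c, by simpa using hc⟩
    obtain ⟨P, hP, hq, hAP⟩ := h.1.exists_le_prime hAq hAtop
    obtain ⟨u, c, hu, hc⟩ := hx _ ⟨P, hP, hq, rfl⟩
    exact hu (hAP (hA.mpr ⟨c, hc.symm⟩))
  · obtain ⟨p, q, hq, rfl⟩ := IsFractionRing.div_surjective (A := D) x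
    have hq0 : q ≠ 0 := nonZeroDivisors.ne_zero hq
    have hp0 : p ≠ 0 := by
      rintro rfl
      simp at hx
    have hfin := (h.finite_primes_mem hp0).union (h.finite_primes_mem hq0)
    refine (hfin.biUnion (t := fun P => {V | ∃ (hP : P.IsPrime) (hq : s.IsQuasiIdeal P),
      V = localization h.2 hP hq}) fun P _ => Set.Subsingleton.finite ?_).subset ?_
    · rintro _ ⟨_, _, rfl⟩ _ ⟨_, _, rfl⟩
      rfl
    · rintro _ ⟨⟨P, hP, hPq, rfl⟩, hne⟩
      refine Set.mem_biUnion ?_ ⟨hP, hPq, rfl⟩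
      by_contra hmem
      rw [Set.mem_union, not_or] at hmem
      apply hne
      rw [map_div₀,
        (valuation_localization_eq_one_iff h.2 hP hPq hp0).mpr fun hm => hmem.1 ⟨hP, hPq, hm⟩,
        (valuation_localization_eq_one_iff h.2 hP hPq hq0).mpr fun hm => hmem.2 ⟨hP, hPq, hm⟩,
        div_one]

end Domain

end SemistarOperation

theorem theorem4p5 {D K : Type*} [CommRing D] [IsDomain D] [Field K] [Algebra D K]
    [IsFractionRing D K] :
    (∀ s s' : SemistarOperation D K, s ≤ s' → s.IsDedekind → s'.IsDedekind) ∧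
    (IsDedekindDomain D → ∀ s : SemistarOperation D K, s.IsDedekind) ∧
    (∀ s : SemistarOperation D K, s.IsSemiStar → s.IsDedekind → IsKrullDomain D K) ∧
    (∀ (s : SemistarOperation D K) (T : Subalgebra D K) (s' : SemistarOperation T K),
      s.IsLinked T s' → s.IsDedekind → s'.IsDedekind) ∧
    (∀ s : SemistarOperation D K, s.IsDedekind → s.dot.IsDedekind) :=
  ⟨fun _ _ hle h => h.of_le hle, fun hD s => s.isDedekind_of_isDedekindDomain hD,
    fun _ hs h => h.isKrullDomain hs, fun _ _ _ hl h => h.of_isLinked hl,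
    fun s h => h.of_isLinked s.isLinked_dot⟩
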